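/- Let $G$ be a finite simple graph on $N$ vertices with a fixed triangulating embedding in the plane: $G$ is connected and every face, the outer one included, is bounded by a triangle. (A plane embedding is given combinatorially, i.e. up to homeomorphism of the sphere, by the cyclic orders of the edges around the vertices; planarity means that Euler's formula $N-|E(G)|+|F|=2$ holds, $F$ being the set of faces.) Let $J=(J_e)_{e\in E(G)}$ be arbitrary real interactions, and let $X\in\{\pm1\}^{V(G)}$ be distributed according to the zero-field Ising model $$\mathbb P(X)=\frac1Z\exp\Big(\sum_{e=\{v,w\}\in E(G)}J_e x_v x_w\Big),\qquad Z=\sum_{X\in\{\pm1\}^{V(G)}}\exp\Big(\sum_{e=\{v,w\}\in E(G)}J_ex_vx_w\Big).$$ The expanded dual graph $G^*$ is obtained from the dual graph of $G$ (vertices: the faces of $G$; one dual edge crossing each edge of $G$; every dual vertex has degree $3$) by replacing each dual vertex by a triangle, called a Fisher city, so that each vertex of the triangle is incident to exactly one of the three dual edges at that face. The edges of $G^*$ outside the triangles are the intercity edges; their set is $E^*_I$, the remaining edges form $E^*_C$, and $g:E^*_I\to E(G)$ is the bijection taking an intercity edge to the edge of $G$ that it crosses. Let $\mathrm{PM}(G^*)$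 be the set of perfect matchings of $G^*$ (sets of pairwise disjoint edges covering all vertices). For a spin configuration $X$ let $I(X)=\{e^*\in E^*_I : g(e^*)=\{v,w\},\ x_v=x_w\}$, and let $M(X)\in\mathrm{PM}(G^*)$ be the unique perfect matching obtained from $I(X)$ by adding edges of $E^*_C$. Put $c_{e^*}=\exp(2J_{g(e^*)})$ for $e^*\in E^*_I$ and $c_{e^*}=1$ for $e^*\in E^*_C$. Then for every $E'\in\mathrm{PM}(G^*)$ $$\mathbb P(M(X)=E')=\frac1{Z^*}\prod_{e^*\in E'}c_{e^*},$$ where $$Z^*:=\sum_{E'\in\mathrm{PM}(G^*)}\ \prod_{e^*\in E'}c_{e^*}=\frac12\,Z\exp\Big(\sum_{e\in E(G)}J_e\Big).$$ -/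

import Mathlib

set_option linter.unusedSectionVars false

noncomputable section

namespace PlanarIsing

variable {V : Type*} [Fintype V] [DecidableEq V]

/-! ### Ising models -/

/-- A spin configuration in `{±1}^V`. -/
abbrev SpinConfig (V : Type*) := V → ℤˣ

/-- The value `x_v x_w` of a spin configuration `x` on the unordered pair `e = {v, w}`. -/
def edgeSpin (X : SpinConfig V) (e : Sym2 V) : ℤˣ := (Sym2.map X e).mul

/-- The weight `exp (∑ v, μ_v x_v + ∑ {v, w} ∈ E(G), J_{v,w} x_v x_w)`. -/
def isingWeight (G : SimpleGraph V) [DecidableRel G.Adj] (μ : V → ℝ) (J : G.edgeSet → ℝ)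
    (X : SpinConfig V) : ℝ :=
  Real.exp (∑ v, μ v * ((X v : ℤ) : ℝ) + ∑ e : G.edgeSet, J e * ((edgeSpin X e : ℤ) : ℝ))

/-- The partition function `Z` of the Ising model `⟨G, μ, J⟩`. -/
def isingZ (G : SimpleGraph V) [DecidableRel G.Adj] (μ : V → ℝ) (J : G.edgeSet → ℝ) : ℝ :=
  ∑ X : SpinConfig V, isingWeight G μ J X

theorem isingZ_pos (G : SimpleGraph V) [DecidableRel G.Adj] (μ : V → ℝ) (J : G.edgeSet → ℝ) :
    0 < isingZ G μ J :=
  Finset.sum_pos (fun _ _ => Real.exp_pos _) Finset.univ_nonempty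

theorem ising_sum_eq_one (G : SimpleGraph V) [DecidableRel G.Adj] (μ : V → ℝ)
    (J : G.edgeSet → ℝ) :
    ∑ X : SpinConfig V, ENNReal.ofReal (isingWeight G μ J X / isingZ G μ J) = 1 := by
  have hpos : ∀ X : SpinConfig V, 0 ≤ isingWeight G μ J X / isingZ G μ J :=
    fun X => div_nonneg (Real.exp_pos _).le (isingZ_pos G μ J).le
  rw [← ENNReal.ofReal_sum_of_nonneg (fun X _ => hpos X), ← Finset.sum_div]
  change ENNReal.ofReal (isingZ G μ J / isingZ G μ J) = 1
  rw [div_self (isingZ_pos G μ J).ne', ENNReal.ofReal_one]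

/-- The law of the random spin configuration of the Ising model `⟨G, μ, J⟩`:
configuration `X` has probability `isingWeight X / Z`. -/
def isingLaw (G : SimpleGraph V) [DecidableRel G.Adj] (μ : V → ℝ) (J : G.edgeSet → ℝ) :
    PMF (SpinConfig V) :=
  PMF.ofFintype (fun X => ENNReal.ofReal (isingWeight G μ J X / isingZ G μ J))
    (ising_sum_eq_one G μ J)

/-! ### Perfect matchings -/

open Classical in
/-- The perfect matchings of `H`: sets of edges of `H` that are pairwise disjoint and cover all
vertices, i.e. such that every vertex lies on exactly one edge of the set. -/
def perfectMatchings {W : Type*} [Fintype W] (H : SimpleGraph W) : Finset (Finset (Sym2 W)) :=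
  Finset.univ.filter fun E => (∀ e ∈ E, e ∈ H.edgeSet) ∧ ∀ w : W, ∃! e, e ∈ E ∧ w ∈ e

theorem mem_perfectMatchings {W : Type*} [Fintype W] {H : SimpleGraph W} {E : Finset (Sym2 W)} :
    E ∈ perfectMatchings H ↔ (∀ e ∈ E, e ∈ H.edgeSet) ∧ ∀ w : W, ∃! e, e ∈ E ∧ w ∈ e := by
  simp [perfectMatchings]

/-- The weight `∏ e ∈ E, c_e` of a set of edges. -/
def matchingWeight {W : Type*} (c : Sym2 W → ℝ) (E : Finset (Sym2 W)) : ℝ := ∏ e ∈ E, c e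

/-- The partition function of the perfect matching model on `H` with edge weights `c`. -/
def matchingZ {W : Type*} [Fintype W] (H : SimpleGraph W) (c : Sym2 W → ℝ) : ℝ :=
  ∑ E ∈ perfectMatchings H, matchingWeight c E

/-! ### Plane embeddings and triangulations -/

/-- A rotation system of a simple graph: a cyclic order on the darts (oriented edges) leaving each
vertex, given as a permutation `next` of all the darts whose cycles are exactly the sets of darts
with a common initial vertex. -/
structure RotationSystem (G : SimpleGraph V) where
  next : Equiv.Perm G.Dart
  fst_next : ∀ d : G.Dart, (next d).fst = d.fst
  sameCycle_next : ∀ d d' : G.Dart, d.fst = d'.fst → next.SameCycle d d'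

namespace RotationSystem

variable {G : SimpleGraph V} (R : RotationSystem G)

/-- The face permutation: traverse the dart `d`, then leave its end point along the successor of
the reversed dart. Its cycles are the boundary walks of the faces of the embedding. -/
def faceNext : Equiv.Perm G.Dart :=
  (Function.Involutive.toPerm _ (SimpleGraph.Dart.symm_involutive (G := G))).trans R.next

/-- Two darts lie on the boundary of the same face. Each edge of `G` carries two darts, one for
each of its sides. -/
def SameFace (d d' : G.Dart) : Prop := R.faceNext.SameCycle d d'

/-- The set of faces, i.e. of cycles of the face permutation (for a graph with no isolated
vertex). The outer face is one of them. -/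
def Face : Type _ := Quotient (Equiv.Perm.SameCycle.setoid R.faceNext)

end RotationSystem

/-- A triangulated plane graph, with its embedding in the plane given combinatorially, up to
homeomorphism of the sphere: a rotation system of a connected simple graph which has genus zero
(Euler's formula `N - |E| + |F| = 2`) and all of whose faces, the outer one included, are
bounded by three darts. -/
structure PlaneTriangulation (G : SimpleGraph V) [DecidableRel G.Adj] extends
    RotationSystem G where
  connected : G.Connected
  euler : Fintype.card V + Nat.card toRotationSystem.Face = G.edgeFinset.card + 2
  card_face : ∀ d : G.Dart, Nat.card {d' : G.Dart // toRotationSystem.SameFace d d'} = 3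

namespace PlaneTriangulation

variable {G : SimpleGraph V} [DecidableRel G.Adj] (T : PlaneTriangulation G)

/-! ### The expanded dual graph -/

/-- The expanded dual graph `G*`. Every face `f` of `G` is a vertex of degree three of the dual
graph and is replaced by a triangle (a Fisher city), whose three vertices correspond to the three
darts `d` on the boundary of `f`; the vertex `d` is the one incident to the dual edge that crosses
the edge of `d`, and that dual edge leads to the vertex `d.symm` of the city on the other side. -/
def expandedDual : SimpleGraph G.Dart where
  Adj d d' := d ≠ d' ∧ (T.SameFace d d' ∨ d' = d.symm)
  symm := ⟨fun d d' h => ⟨h.1.symm, h.2.imp (fun h => h.symm) (fun h => by simp [h])⟩⟩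
  loopless := ⟨fun d h => h.1 rfl⟩

/-- The set `E*_I` of the intercity edges of `G*`, which join the two sides of an edge of `G`. The
other edges of `G*` join vertices of one Fisher city. -/
def intercity (G : SimpleGraph V) : Set (Sym2 G.Dart) :=
  {e | ∃ d : G.Dart, e = s(d, d.symm)}

/-- The bijection `g` from `E*_I` to `E(G)` which takes an intercity edge of `G*` to the edge of
`G` that it crosses. -/
def crossed (e : intercity G) : G.edgeSet :=
  ⟨e.2.choose.edge, e.2.choose.edge_mem⟩

theorem crossed_mk (d : G.Dart) (h : s(d, d.symm) ∈ intercity G) :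
    (crossed ⟨s(d, d.symm), h⟩ : Sym2 V) = d.edge := by
  have h1 : s(d, d.symm) = s(h.choose, h.choose.symm) := h.choose_spec
  change h.choose.edge = d.edge
  rw [Sym2.eq_iff] at h1
  rw [SimpleGraph.dart_edge_eq_iff]
  rcases h1 with h1 | h1
  · exact Or.inl h1.1.symm
  · exact Or.inr h1.2.symm

open Classical in
/-- The weights on `G*`: `exp (2 J_{g(e)})` if `e` is an intercity edge, and `1` otherwise. -/
def dualWeight (J : G.edgeSet → ℝ) (e : Sym2 G.Dart) : ℝ :=
  if h : e ∈ intercity G then Real.exp (2 * J (crossed ⟨e, h⟩)) else 1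

/-! ### The perfect matching `M(X)` of a spin configuration -/

open Classical in
/-- The set `I(X)` of the intercity edges `e` of `G*` with `g(e) = {v, w}` and `x_v = x_w`. -/
def satIntercity (G : SimpleGraph V) [DecidableRel G.Adj] (X : SpinConfig V) :
    Finset (Sym2 G.Dart) :=
  Finset.univ.filter fun e => ∃ h : e ∈ intercity G, ∃ v w : V,
    (crossed ⟨e, h⟩ : Sym2 V) = s(v, w) ∧ X v = X w

theorem mem_satIntercity {X : SpinConfig V} {e : Sym2 G.Dart} :
    e ∈ satIntercity G X ↔ ∃ d : G.Dart, e = s(d, d.symm) ∧ X d.fst = X d.snd := by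
  simp only [satIntercity, Finset.mem_filter, Finset.mem_univ, true_and]
  constructor
  · rintro ⟨⟨d, rfl⟩, v, w, h, hX⟩
    refine ⟨d, rfl, ?_⟩
    replace h := (crossed_mk d ⟨d, rfl⟩).symm.trans h
    rw [SimpleGraph.Dart.edge, Sym2.eq_iff] at h
    rcases h with ⟨rfl, rfl⟩ | ⟨rfl, rfl⟩
    · exact hX
    · exact hX.symm
  · rintro ⟨d, rfl, hX⟩
    exact ⟨⟨d, rfl⟩, d.fst, d.snd, crossed_mk d _, hX⟩

theorem fst_faceNext (d : G.Dart) : (T.faceNext d).fst = d.snd :=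
  T.fst_next d.symm

theorem faceNext_ne (d : G.Dart) : T.faceNext d ≠ d := fun h =>
  d.fst_ne_snd (by rw [← T.fst_faceNext d, h])

theorem faceNext_cube (d : G.Dart) : T.faceNext (T.faceNext (T.faceNext d)) = d := by
  classical
  have h3 := T.card_face d
  have hs : (T.faceNext.cycleOf d).support.card = 3 := by
    rw [← h3, Nat.card_eq_fintype_card, Fintype.card_subtype]
    congr 1
    ext x
    simp only [Finset.mem_filter, Finset.mem_univ, true_and]
    rw [Equiv.Perm.mem_support_cycleOf_iff' (T.faceNext_ne d)]
    rfl
  have ho : orderOf (T.faceNext.cycleOf d) = 3 := by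
    rw [(Equiv.Perm.isCycle_cycleOf _ (T.faceNext_ne d)).orderOf, hs]
  have h := Equiv.Perm.cycleOf_pow_apply_self T.faceNext d 3
  rw [← ho, pow_orderOf_eq_one, ho] at h
  simpa [pow_succ] using h.symm

theorem sameFace_iff {d d' : G.Dart} :
    T.SameFace d d' ↔ d' = d ∨ d' = T.faceNext d ∨ d' = T.faceNext (T.faceNext d) := by
  constructor
  · intro h
    obtain ⟨n, -, rfl⟩ := Equiv.Perm.SameCycle.exists_pow_eq' h
    induction n with
    | zero => exact Or.inl rfl
    | succ n ih =>
      rw [pow_succ', Equiv.Perm.mul_apply]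
      rcases ih ⟨n, by simp⟩ with ih | ih | ih <;> rw [ih]
      · exact Or.inr (Or.inl rfl)
      · exact Or.inr (Or.inr rfl)
      · exact Or.inl (T.faceNext_cube d)
  · rintro (rfl | rfl | rfl)
    · exact Equiv.Perm.SameCycle.refl _ _
    · exact ⟨1, by simp⟩
    · exact ⟨2, by simp [zpow_ofNat, pow_succ]⟩

theorem faceNext_ne_symm (d : G.Dart) : T.faceNext d ≠ d.symm := by
  intro h
  have h1 := T.fst_faceNext (T.faceNext d)
  have h2 := T.fst_faceNext (T.faceNext (T.faceNext d))
  rw [T.faceNext_cube d, h] at h2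
  rw [h] at h1
  exact (T.faceNext d.symm).fst_ne_snd (h1.trans h2)

theorem edge_cases {d : G.Dart} {e : Sym2 G.Dart} (he : e ∈ T.expandedDual.edgeSet) (hd : d ∈ e) :
    e = s(d, d.symm) ∨ e = s(d, T.faceNext d) ∨
      e = s(T.faceNext (T.faceNext d), d) := by
  obtain ⟨d', rfl⟩ := Sym2.mem_iff_exists.1 hd
  rw [SimpleGraph.mem_edgeSet] at he
  obtain ⟨hne, h | h⟩ := he
  · rcases T.sameFace_iff.1 h with h | h | h
    · exact absurd h.symm hne
    · right; left; rw [h]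
    · right; right; rw [h, Sym2.eq_swap]
  · left; rw [h]

theorem city_not_intercity (d : G.Dart) : s(d, T.faceNext d) ∉ intercity G := by
  rintro ⟨x, h⟩
  rw [Sym2.eq_iff] at h
  rcases h with ⟨rfl, h⟩ | ⟨rfl, h⟩
  · exact T.faceNext_ne_symm _ h
  · exact T.faceNext_ne_symm _ (by rw [h, SimpleGraph.Dart.symm_symm])

/-- The set `I(X)` can be uniquely completed to a perfect matching of `G*` by edges of the Fisher
cities. -/
theorem existsUnique_completion (X : SpinConfig V) :
    ∃! E : perfectMatchings T.expandedDual,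
      ∀ e ∈ intercity G, e ∈ E.1 ↔ e ∈ satIntercity G X := by
  classical
  let sat : G.Dart → Prop := fun d => X d.fst = X d.snd
  have hsymm : ∀ d : G.Dart, sat d.symm ↔ sat d := fun d => eq_comm
  have hparity : ∀ d : G.Dart, (sat d ∧ (sat (T.faceNext d) ↔ sat (T.faceNext (T.faceNext d)))) ∨
      (¬ sat d ∧ (sat (T.faceNext d) ↔ ¬ sat (T.faceNext (T.faceNext d)))) := by
    intro d
    have h1 := T.fst_faceNext d
    have h2 := T.fst_faceNext (T.faceNext d)
    have h3 := T.fst_faceNext (T.faceNext (T.faceNext d))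
    rw [T.faceNext_cube] at h3
    simp only [sat, ← h1, ← h2, ← h3]
    rcases Int.units_eq_one_or (X d.fst) with a | a <;>
    rcases Int.units_eq_one_or (X (T.faceNext d).fst) with b | b <;>
    rcases Int.units_eq_one_or (X (T.faceNext (T.faceNext d)).fst) with c | c <;>
    rw [a, b, c] <;> decide
  let E : Finset (Sym2 G.Dart) := Finset.univ.filter fun e =>
    (∃ d : G.Dart, e = s(d, d.symm) ∧ sat d) ∨
    (∃ d : G.Dart, e = s(d, T.faceNext d) ∧ ¬ sat d ∧ ¬ sat (T.faceNext d))
  have hE : ∀ e, e ∈ E ↔ (∃ d : G.Dart, e = s(d, d.symm) ∧ sat d) ∨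
      (∃ d : G.Dart, e = s(d, T.faceNext d) ∧ ¬ sat d ∧ ¬ sat (T.faceNext d)) := by
    intro e; simp [E]
  have hEI : ∀ e ∈ intercity G, e ∈ E ↔ e ∈ satIntercity G X := by
    intro e he
    rw [hE, mem_satIntercity]
    constructor
    · rintro (h | ⟨d, rfl, -⟩)
      · exact h
      · exact absurd he (T.city_not_intercity d)
    · exact Or.inl
  have hsub : ∀ e ∈ E, e ∈ T.expandedDual.edgeSet := by
    intro e he
    rcases (hE e).1 he with ⟨d, rfl, -⟩ | ⟨d, rfl, -⟩
    · exact (SimpleGraph.mem_edgeSet _).2 ⟨d.symm_ne.symm, Or.inr rfl⟩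
    · exact (SimpleGraph.mem_edgeSet _).2
        ⟨(T.faceNext_ne d).symm, Or.inl (T.sameFace_iff.2 (Or.inr (Or.inl rfl)))⟩
  have hI : ∀ d : G.Dart, s(d, d.symm) ∈ E ↔ sat d := by
    intro d
    rw [hEI _ ⟨d, rfl⟩, mem_satIntercity]
    constructor
    · rintro ⟨x, h, hx⟩
      rw [Sym2.eq_iff] at h
      rcases h with ⟨rfl, -⟩ | ⟨rfl, -⟩
      · exact hx
      · exact hx.symm
    · exact fun h => ⟨d, rfl, h⟩
  have hC : ∀ d : G.Dart, s(d, T.faceNext d) ∈ E ↔ ¬ sat d ∧ ¬ sat (T.faceNext d) := by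
    intro d
    rw [hE]
    constructor
    · rintro (⟨x, h, -⟩ | ⟨x, h, hx⟩)
      · exact absurd ⟨x, h⟩ (T.city_not_intercity d)
      · rw [Sym2.eq_iff] at h
        rcases h with ⟨rfl, -⟩ | ⟨rfl, h⟩
        · exact hx
        · exact ⟨hx.2, by rw [h]; exact hx.1⟩
    · exact fun h => Or.inr ⟨d, rfl, h⟩
  have hPM : E ∈ perfectMatchings T.expandedDual := by
    refine mem_perfectMatchings.2 ⟨hsub, fun d => ?_⟩
    have hC2 := hC (T.faceNext (T.faceNext d))
    rw [T.faceNext_cube] at hC2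
    have hp := hparity d
    by_cases h : sat d
    · refine ⟨s(d, d.symm), ⟨(hI d).2 h, by simp⟩, ?_⟩
      rintro e ⟨he, hd⟩
      rcases T.edge_cases (hsub e he) hd with rfl | rfl | rfl
      · rfl
      · exact absurd h ((hC d).1 he).1
      · exact absurd h (hC2.1 he).2
    · by_cases h1 : sat (T.faceNext d)
      · have h2 : ¬ sat (T.faceNext (T.faceNext d)) := by tauto
        refine ⟨s(T.faceNext (T.faceNext d), d), ⟨hC2.2 ⟨h2, h⟩, by simp⟩, ?_⟩
        rintro e ⟨he, hd⟩
        rcases T.edge_cases (hsub e he) hd with rfl | rfl | rfl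
        · exact absurd ((hI d).1 he) h
        · exact absurd h1 ((hC d).1 he).2
        · rfl
      · have h2 : sat (T.faceNext (T.faceNext d)) := by tauto
        refine ⟨s(d, T.faceNext d), ⟨(hC d).2 ⟨h, h1⟩, by simp⟩, ?_⟩
        rintro e ⟨he, hd⟩
        rcases T.edge_cases (hsub e he) hd with rfl | rfl | rfl
        · exact absurd ((hI d).1 he) h
        · rfl
        · exact absurd h2 (hC2.1 he).1
  refine ⟨⟨E, hPM⟩, hEI, ?_⟩
  rintro ⟨E', hE'⟩ hE'I
  obtain ⟨hsub', huniq'⟩ := mem_perfectMatchings.1 hE'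
  have hI' : ∀ d : G.Dart, s(d, d.symm) ∈ E' ↔ sat d := fun d => by
    rw [hE'I _ ⟨d, rfl⟩, ← hEI _ ⟨d, rfl⟩, hI]
  have hCsub : ∀ d : G.Dart, s(d, T.faceNext d) ∈ E' → s(d, T.faceNext d) ∈ E := by
    intro d hd
    have key : ∀ x : G.Dart, x ∈ s(d, T.faceNext d) → ¬ sat x := by
      intro x hx hs
      have := (huniq' x).unique ⟨hd, hx⟩ ⟨(hI' x).2 hs, by simp⟩
      exact T.city_not_intercity d ⟨x, this⟩
    exact (hC d).2 ⟨key _ (by simp), key _ (by simp)⟩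
  have hsubset : ∀ e ∈ E', e ∈ E := by
    intro e he
    induction e with
    | h a b =>
      rcases T.edge_cases (d := a) (hsub' _ he) (by simp) with h | h | h
      · rw [h] at he ⊢
        exact (hI a).2 ((hI' a).1 he)
      · rw [h] at he ⊢
        exact hCsub a he
      · rw [h] at he ⊢
        have := hCsub (T.faceNext (T.faceNext a))
        rw [T.faceNext_cube] at this
        exact this he
  apply Subtype.ext
  change E' = E
  refine Finset.Subset.antisymm hsubset fun e he => ?_
  induction e with
  | h a b =>
    obtain ⟨e', ⟨he', ha'⟩, -⟩ := huniq' a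
    have := ((mem_perfectMatchings.1 hPM).2 a).unique ⟨he, by simp⟩ ⟨hsubset e' he', ha'⟩
    rw [this]
    exact he'

/-- The perfect matching `M(X)` of `G*`: the unique one whose set of intercity edges is `I(X)`. -/
def matchingOf (X : SpinConfig V) : perfectMatchings T.expandedDual :=
  (T.existsUnique_completion X).choose

/-- The intercity edges of `M(X)` are exactly those of `I(X)`. -/
theorem mem_matchingOf_iff (X : SpinConfig V) :
    ∀ e ∈ intercity G, e ∈ (T.matchingOf X).1 ↔ e ∈ satIntercity G X :=
  (T.existsUnique_completion X).choose_spec.1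

end PlaneTriangulation

end PlanarIsing

end

namespace PlanarIsing

/-! The map from `X` to `M(X)` is two-to-one onto the perfect matchings and multiplies weights by
the constant `exp (∑ J_e)`; both claims follow by summing over its fibres.

Weights: a satisfied edge carries `exp (2 J_e) = exp (J_e) * exp (J_e)`, an unsatisfied one `1 = exp
(-J_e) * exp (J_e)` (`matchingWeight_matchingOf`).

Fibres: `M(X)` records exactly which edges are satisfied, so by connectedness it determines `X` up
to a global sign (`matchingOf_eq_matchingOf_iff`).

Surjectivity is where planarity enters. A perfect matching has an odd number of intercity edges at
each city (`intercity_parity`), so the edges of `G` crossed by no matching edge form a `ZMod 2`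
cocycle: each triangle has an even number of them. On the sphere every cocycle is the coboundary of
a function on the vertices (`range_vertexCoboundary`), and that function is the required spin
configuration. The vanishing of cohomology is a rank count using Euler's formula and connectedness
of both `G` and its dual. -/

/-- The coboundary of a function on the vertices, with values in `ZMod 2`. -/
noncomputable def vertexCoboundary {V : Type*} (G : SimpleGraph V) :
    (V → ZMod 2) →ₗ[ZMod 2] (G.edgeSet → ZMod 2) where
  toFun s e := Sym2.lift ⟨fun a b => s a + s b, fun _ _ => add_comm _ _⟩ e.1
  map_add' s t := by
    ext ⟨e, he⟩
    induction e with
    | h a b => simp only [Sym2.lift_mk, Pi.add_apply]; ring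
  map_smul' c s := by
    ext ⟨e, he⟩
    induction e with
    | h a b => simp only [Sym2.lift_mk, Pi.smul_apply, smul_eq_mul, RingHom.id_apply]; ring

theorem vertexCoboundary_edge {V : Type*} {G : SimpleGraph V} (s : V → ZMod 2) (d : G.Dart) :
    vertexCoboundary G s ⟨d.edge, d.edge_mem⟩ = s d.fst + s d.snd := rfl

theorem eq_of_connected {V α : Type*} {G : SimpleGraph V} (hG : G.Connected) (f : V → α)
    (h : ∀ d : G.Dart, f d.fst = f d.snd) (v w : V) : f v = f w := by
  obtain ⟨p⟩ := hG.preconnected v w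
  induction p with
  | nil => rfl
  | cons hadj _ ih => exact (h ⟨(_, _), hadj⟩).trans ih

theorem finrank_le_one_of_constant {K ι : Type*} [Field K] [Nonempty ι]
    (W : Submodule K (ι → K)) (h : ∀ f ∈ W, ∀ i j, f i = f j) : Module.finrank K W ≤ 1 := by
  obtain ⟨i⟩ := ‹Nonempty ι›
  have hinj : Function.Injective ((LinearMap.proj i : (ι → K) →ₗ[K] K).comp W.subtype) := by
    intro x y hxy
    ext j
    have hx := h x.1 x.2 i j
    have hy := h y.1 y.2 i j
    exact hx.symm.trans (Eq.trans hxy hy)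
  simpa using LinearMap.finrank_le_finrank_of_injective hinj

namespace PlaneTriangulation

variable {V : Type*} [Fintype V] [DecidableEq V] {G : SimpleGraph V} [DecidableRel G.Adj]
  (T : PlaneTriangulation G)

/-! ### Faces and cohomology mod 2 -/

/-- The face to the side of a dart. -/
def faceOf (d : G.Dart) : T.Face :=
  Quotient.mk (Equiv.Perm.SameCycle.setoid T.faceNext) d

theorem faceOf_eq_iff {d d' : G.Dart} : T.faceOf d = T.faceOf d' ↔ T.SameFace d d' :=
  Quotient.eq

theorem exists_faceOf (f : T.Face) : ∃ d, T.faceOf d = f := Quotient.exists_rep f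

theorem faceOf_faceNext (d : G.Dart) : T.faceOf (T.faceNext d) = T.faceOf d :=
  (T.faceOf_eq_iff.2 (T.sameFace_iff.2 (Or.inr (Or.inl rfl)))).symm

noncomputable instance : Fintype T.Face :=
  @Fintype.ofFinite _ (Quotient.finite _)

open scoped Classical in
/-- The incidence matrix of faces and edges over `ZMod 2`, counting the darts of an edge that lie
on the boundary of a face. -/
noncomputable def incidence : Matrix T.Face G.edgeSet (ZMod 2) := fun f e =>
  ∑ d : G.Dart, if T.faceOf d = f ∧ d.edge = e.1 then 1 else 0

/-- The boundary of a face consists of three distinct darts. Since `incidence` counts darts,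
distinctness of their edges is not needed. -/
theorem incidence_mulVec (u : G.edgeSet → ZMod 2) (d : G.Dart) :
    (T.incidence.mulVec u) (T.faceOf d) = u ⟨d.edge, d.edge_mem⟩ +
      u ⟨(T.faceNext d).edge, (T.faceNext d).edge_mem⟩ +
      u ⟨(T.faceNext (T.faceNext d)).edge, (T.faceNext (T.faceNext d)).edge_mem⟩ := by
  classical
  have h1 : (T.incidence.mulVec u) (T.faceOf d) =
      ∑ x : G.Dart, if T.faceOf d = T.faceOf x then u ⟨x.edge, x.edge_mem⟩ else 0 := by
    simp only [Matrix.mulVec, dotProduct, incidence, Finset.sum_mul]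
    rw [Finset.sum_comm]
    refine Finset.sum_congr rfl fun x _ => ?_
    rw [Finset.sum_eq_single ⟨x.edge, x.edge_mem⟩]
    · simp [eq_comm]
    · intro e _ he
      rw [if_neg, zero_mul]
      rintro ⟨-, h⟩
      exact he (Subtype.ext h.symm)
    · simp
  have hset : (Finset.univ.filter fun x => T.faceOf d = T.faceOf x) =
      {d, T.faceNext d, T.faceNext (T.faceNext d)} := by
    ext x
    simp [T.faceOf_eq_iff, T.sameFace_iff]
  have h2 : d ≠ T.faceNext (T.faceNext d) := fun h => by
    have := T.faceNext_cube d
    rw [← h] at this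
    exact T.faceNext_ne d this
  rw [h1, ← Finset.sum_filter, hset, Finset.sum_insert, Finset.sum_pair, add_assoc]
  · exact (T.faceNext_ne _).symm
  · simp [(T.faceNext_ne d).symm, h2]

theorem incidence_transpose_mulVec (h : T.Face → ZMod 2) (d : G.Dart) :
    (T.incidence.transpose.mulVec h) ⟨d.edge, d.edge_mem⟩ =
      h (T.faceOf d) + h (T.faceOf d.symm) := by
  classical
  have h1 : (T.incidence.transpose.mulVec h) ⟨d.edge, d.edge_mem⟩ =
      ∑ x : G.Dart, if x.edge = d.edge then h (T.faceOf x) else 0 := by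
    simp only [Matrix.mulVec, dotProduct, incidence, Finset.sum_mul, Matrix.transpose_apply]
    rw [Finset.sum_comm]
    refine Finset.sum_congr rfl fun x _ => ?_
    rw [Finset.sum_eq_single (T.faceOf x)]
    · simp
    · intro f _ hf
      rw [if_neg, zero_mul]
      rintro ⟨h, -⟩
      exact hf h.symm
    · simp
  have hset : (Finset.univ.filter fun x : G.Dart => x.edge = d.edge) = {d, d.symm} := by
    ext x
    simp [SimpleGraph.dart_edge_eq_iff]
  rw [h1, ← Finset.sum_filter, hset, Finset.sum_pair d.symm_ne.symm]

/-- Without darts there are no faces, and connectedness leaves at most one vertex, which contradicts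
Euler's formula. -/
theorem nonempty_dart (T : PlaneTriangulation G) : Nonempty G.Dart := by
  by_contra h
  rw [not_nonempty_iff] at h
  have hV : Fintype.card V ≤ 1 := Fintype.card_le_one_iff.2
    (eq_of_connected T.connected id fun d => h.elim d)
  have hF : Nat.card T.Face = 0 := by
    have : IsEmpty T.Face := ⟨fun f => h.elim (T.exists_faceOf f).choose⟩
    exact Nat.card_of_isEmpty
  have := T.euler
  omega

/-- This is connectedness of the dual graph: `h` agrees across every edge, hence on all faces around
a vertex, hence everywhere because `G` is connected. -/
theorem eq_of_incidence_transpose (h : T.Face → ZMod 2)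
    (hh : T.incidence.transpose.mulVec h = 0) (f f' : T.Face) : h f = h f' := by
  have hsymm (d : G.Dart) : h (T.faceOf d.symm) = h (T.faceOf d) := by
    have := T.incidence_transpose_mulVec h d
    rw [hh, Pi.zero_apply] at this
    exact (CharTwo.add_eq_zero.1 this.symm).symm
  -- `next d` is `faceNext d.symm`, so it lies on the face across the edge of `d`.
  have hnext (d : G.Dart) : h (T.faceOf (T.next d)) = h (T.faceOf d) := by
    rw [← hsymm d, ← T.faceOf_faceNext d.symm]
    exact congrArg (fun x => h (T.faceOf (T.next x))) d.symm_symm.symm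
  have hcycle (d d' : G.Dart) (hd : d.fst = d'.fst) : h (T.faceOf d) = h (T.faceOf d') := by
    obtain ⟨n, -, rfl⟩ := (T.sameCycle_next d d' hd).exists_pow_eq'
    clear hd
    induction n with
    | zero => rfl
    | succ n ih => rw [pow_succ', Equiv.Perm.mul_apply, hnext]; exact ih
  -- Taking the set of values of `h` around `v` avoids choosing a dart at each vertex.
  let values (v : V) : Set (ZMod 2) := {a | ∃ d : G.Dart, d.fst = v ∧ h (T.faceOf d) = a}
  have hvertex (v w : V) : values v = values w := by
    refine eq_of_connected T.connected values (fun d => ?_) v w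
    ext a
    constructor
    · rintro ⟨x, hx, rfl⟩
      exact ⟨d.symm, rfl, (hsymm d).trans (hcycle _ _ hx.symm)⟩
    · rintro ⟨x, hx, rfl⟩
      exact ⟨d, rfl, (hsymm d).symm.trans (hcycle _ _ hx.symm)⟩
  obtain ⟨d, rfl⟩ := T.exists_faceOf f
  obtain ⟨d', rfl⟩ := T.exists_faceOf f'
  have hmem : h (T.faceOf d) ∈ values d.fst := ⟨d, rfl, rfl⟩
  rw [hvertex d.fst d'.fst] at hmem
  obtain ⟨x, hx, hxa⟩ := hmem
  rw [← hxa]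
  exact hcycle _ _ hx

/-- The first cohomology of the triangulated sphere with coefficients in `ZMod 2` vanishes. -/
theorem range_vertexCoboundary :
    LinearMap.range (vertexCoboundary G) = LinearMap.ker T.incidence.mulVecLin := by
  obtain ⟨d₀⟩ := T.nonempty_dart
  have hle : LinearMap.range (vertexCoboundary G) ≤ LinearMap.ker T.incidence.mulVecLin := by
    rintro _ ⟨s, rfl⟩
    rw [LinearMap.mem_ker, Matrix.mulVecLin_apply]
    ext f
    obtain ⟨d, rfl⟩ := T.exists_faceOf f
    rw [incidence_mulVec, vertexCoboundary_edge, vertexCoboundary_edge, vertexCoboundary_edge,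
      ← T.fst_faceNext d, ← T.fst_faceNext (T.faceNext d),
      ← T.fst_faceNext (T.faceNext (T.faceNext d)), T.faceNext_cube, Pi.zero_apply]
    have key : ∀ a b c : ZMod 2, a + b + (b + c) + (c + a) = 0 := by decide
    exact key _ _ _
  refine Submodule.eq_of_le_of_finrank_le hle ?_
  have : Nonempty T.Face := ⟨T.faceOf d₀⟩
  have : Nonempty V := ⟨d₀.fst⟩
  have h1 : Module.finrank (ZMod 2) (LinearMap.ker (vertexCoboundary G)) ≤ 1 := by
    refine finrank_le_one_of_constant _ fun s hs => eq_of_connected T.connected s fun d => ?_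
    have := congrFun (LinearMap.mem_ker.1 hs) ⟨d.edge, d.edge_mem⟩
    exact CharTwo.add_eq_zero.1 this
  have h2 : Module.finrank (ZMod 2) (LinearMap.ker T.incidence.transpose.mulVecLin) ≤ 1 :=
    finrank_le_one_of_constant _ fun h hh => T.eq_of_incidence_transpose h hh
  -- The coboundary has rank at least `N - 1`. The incidence matrix has the rank of its transpose,
  -- at least `|F| - 1`, so its kernel has dimension at most `|E| - |F| + 1 = N - 1`.
  have e1 := (vertexCoboundary G).finrank_range_add_finrank_ker
  have e2 := T.incidence.mulVecLin.finrank_range_add_finrank_ker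
  have e3 := T.incidence.transpose.mulVecLin.finrank_range_add_finrank_ker
  have e4 := T.incidence.rank_transpose
  have e5 := T.euler
  rw [Matrix.rank, Matrix.rank] at e4
  rw [Module.finrank_fintype_fun_eq_card] at e1 e2 e3
  rw [Nat.card_eq_fintype_card] at e5
  rw [← SimpleGraph.edgeFinset_card] at e2
  omega

/-! ### The fibres of `matchingOf` -/

theorem mem_matchingOf_dart (X : SpinConfig V) (d : G.Dart) :
    s(d, d.symm) ∈ (T.matchingOf X).1 ↔ X d.fst = X d.snd := by
  rw [T.mem_matchingOf_iff X _ ⟨d, rfl⟩, mem_satIntercity]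
  constructor
  · rintro ⟨x, h, hx⟩
    rw [Sym2.eq_iff] at h
    rcases h with ⟨rfl, -⟩ | ⟨rfl, -⟩
    · exact hx
    · exact hx.symm
  · exact fun h => ⟨d, rfl, h⟩

theorem matchingOf_eq_iff (X : SpinConfig V) (E : perfectMatchings T.expandedDual) :
    T.matchingOf X = E ↔ ∀ d : G.Dart, s(d, d.symm) ∈ E.1 ↔ X d.fst = X d.snd := by
  constructor
  · rintro rfl d
    exact T.mem_matchingOf_dart X d
  · intro h
    refine (T.existsUnique_completion X).unique (T.mem_matchingOf_iff X) ?_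
    rintro _ ⟨d, rfl⟩
    rw [h d, ← T.mem_matchingOf_dart X d, T.mem_matchingOf_iff X _ ⟨d, rfl⟩]

/-- An odd number of the vertices of a Fisher city are matched to other cities. -/
theorem intercity_parity (E : perfectMatchings T.expandedDual) (d : G.Dart) :
    (s(d, d.symm) ∈ E.1 ↔ (s(T.faceNext d, (T.faceNext d).symm) ∈ E.1 ↔
      s(T.faceNext (T.faceNext d), (T.faceNext (T.faceNext d)).symm) ∈ E.1)) := by
  obtain ⟨hsub, huniq⟩ := mem_perfectMatchings.1 E.2
  have hxor (x : G.Dart) : (s(x, x.symm) ∈ E.1 ∨ s(x, T.faceNext x) ∈ E.1 ∨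
      s(T.faceNext (T.faceNext x), x) ∈ E.1) ∧
      ¬ (s(x, x.symm) ∈ E.1 ∧ s(x, T.faceNext x) ∈ E.1) ∧
      ¬ (s(x, x.symm) ∈ E.1 ∧ s(T.faceNext (T.faceNext x), x) ∈ E.1) ∧
      ¬ (s(x, T.faceNext x) ∈ E.1 ∧ s(T.faceNext (T.faceNext x), x) ∈ E.1) := by
    refine ⟨?_, ?_, ?_, ?_⟩
    · obtain ⟨e, ⟨he, hx⟩, -⟩ := huniq x
      rcases T.edge_cases (hsub e he) hx with rfl | rfl | rfl <;> tauto
    · rintro ⟨h1, h2⟩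
      exact T.city_not_intercity x ⟨x, ((huniq x).unique ⟨h1, by simp⟩ ⟨h2, by simp⟩).symm⟩
    · rintro ⟨h1, h2⟩
      have := T.city_not_intercity (T.faceNext (T.faceNext x))
      rw [T.faceNext_cube] at this
      exact this ⟨x, ((huniq x).unique ⟨h1, by simp⟩ ⟨h2, by simp⟩).symm⟩
    · rintro ⟨h1, h2⟩
      have := (huniq x).unique ⟨h1, by simp⟩ ⟨h2, by simp⟩
      rw [Sym2.eq_iff] at this
      rcases this with ⟨-, h⟩ | ⟨-, h⟩
      · exact T.faceNext_ne x h
      · exact T.faceNext_ne _ h.symm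
  -- Each of the three vertices of the city lies on exactly one matching edge. Summing, each city
  -- edge is counted twice, so the number of intercity edges is odd; `grind` checks this
  -- propositionally.
  have a := hxor d
  have b := hxor (T.faceNext d)
  have c := hxor (T.faceNext (T.faceNext d))
  rw [T.faceNext_cube] at b c
  clear hxor hsub huniq
  generalize (s(d, d.symm) ∈ E.1) = p₁ at *
  generalize (s(T.faceNext d, (T.faceNext d).symm) ∈ E.1) = p₂ at *
  generalize (s(T.faceNext (T.faceNext d), (T.faceNext (T.faceNext d)).symm) ∈ E.1) = p₃ at *
  generalize (s(d, T.faceNext d) ∈ E.1) = q₁ at *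
  generalize (s(T.faceNext d, T.faceNext (T.faceNext d)) ∈ E.1) = q₂ at *
  generalize (s(T.faceNext (T.faceNext d), d) ∈ E.1) = q₃ at *
  grind

/-- The indicator `u` of the edges not crossed by the matching is a cocycle by parity, hence the
coboundary of some `s`; reading `s` as signs gives spins that differ exactly across those edges. -/
theorem matchingOf_surjective : Function.Surjective T.matchingOf := by
  classical
  intro E
  let u : G.edgeSet → ZMod 2 := fun e =>
    if ∃ d : G.Dart, d.edge = e.1 ∧ s(d, d.symm) ∈ E.1 then 0 else 1
  have hu (d : G.Dart) : u ⟨d.edge, d.edge_mem⟩ = if s(d, d.symm) ∈ E.1 then 0 else 1 := by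
    have : (∃ x : G.Dart, x.edge = d.edge ∧ s(x, x.symm) ∈ E.1) ↔ s(d, d.symm) ∈ E.1 := by
      constructor
      · rintro ⟨x, hx, hE⟩
        rcases SimpleGraph.dart_edge_eq_iff _ _ |>.1 hx with rfl | rfl
        · exact hE
        · rwa [SimpleGraph.Dart.symm_symm, Sym2.eq_swap] at hE
      · exact fun h => ⟨d, rfl, h⟩
    simp only [u, this]
  have hker : u ∈ LinearMap.ker T.incidence.mulVecLin := by
    rw [LinearMap.mem_ker, Matrix.mulVecLin_apply]
    ext f
    obtain ⟨d, rfl⟩ := T.exists_faceOf f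
    rw [incidence_mulVec, hu, hu, hu, Pi.zero_apply]
    have := T.intercity_parity E d
    split_ifs <;> first | decide | tauto
  rw [← range_vertexCoboundary] at hker
  obtain ⟨s, hs⟩ := hker
  refine ⟨fun v => if s v = 0 then 1 else -1, (T.matchingOf_eq_iff _ E).2 fun d => ?_⟩
  have h := hu d
  rw [← hs, vertexCoboundary_edge] at h
  have key : ∀ a b : ZMod 2, (a + b = 0 ↔
      (if a = 0 then (1 : ℤˣ) else -1) = if b = 0 then 1 else -1) := by decide
  rw [← key, h]
  split_ifs with h' <;> simp [h']

/-- Equal matchings mean that `X` and `Y` satisfy the same edges, that is, the product `X v * Y v`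
is constant along edges, hence constant on the connected graph. -/
theorem matchingOf_eq_matchingOf_iff (X Y : SpinConfig V) :
    T.matchingOf Y = T.matchingOf X ↔ Y = X ∨ Y = -X := by
  have key : ∀ a b c d : ℤˣ, ((a = b ↔ c = d) ↔ a * c = b * d) := by decide
  have key2 : ∀ a b : ℤˣ, (b = a ↔ a * b = 1) ∧ (b = -a ↔ a * b = -1) := by decide
  rw [matchingOf_eq_iff]
  simp only [mem_matchingOf_dart, key]
  constructor
  · intro h
    have hc := eq_of_connected T.connected (fun v => X v * Y v) h
    obtain ⟨v⟩ := T.connected.nonempty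
    rcases Int.units_eq_one_or (X v * Y v) with hv | hv
    · exact Or.inl (funext fun w => (key2 _ _).1.2 ((hc w v).trans hv))
    · exact Or.inr (funext fun w => (key2 _ _).2.2 ((hc w v).trans hv))
  · rintro (rfl | rfl) d
    · simp
    · simp

open scoped Classical in
theorem card_fiber_matchingOf (E : perfectMatchings T.expandedDual) :
    (Finset.univ.filter fun X => T.matchingOf X = E).card = 2 := by
  obtain ⟨X, rfl⟩ := T.matchingOf_surjective E
  have : (Finset.univ.filter fun Y => T.matchingOf Y = T.matchingOf X) = {X, -X} := by
    ext Y
    simp [matchingOf_eq_matchingOf_iff]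
  rw [this, Finset.card_pair]
  intro h
  obtain ⟨v⟩ := T.connected.nonempty
  have key : ∀ a : ℤˣ, a ≠ -a := by decide
  exact key _ (congrFun h v)

/-! ### Weights, partition function and law -/

theorem edgeSpin_edge (X : SpinConfig V) (d : G.Dart) :
    edgeSpin X d.edge = X d.fst * X d.snd := rfl

/-- The weight of `M(X)` is that of `X` up to a constant. -/
theorem matchingWeight_matchingOf (J : G.edgeSet → ℝ) (X : SpinConfig V) :
    matchingWeight (dualWeight J) (T.matchingOf X).1 =
      isingWeight G 0 J X * Real.exp (∑ e : G.edgeSet, J e) := by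
  classical
  have hmem {e : Sym2 G.Dart} (he : e ∈ satIntercity G X) : e ∈ intercity G := by
    obtain ⟨d, rfl, -⟩ := mem_satIntercity.1 he
    exact ⟨d, rfl⟩
  have key : ∀ a b : ℤˣ, a * b = 1 ↔ a = b := by decide
  -- City edges have weight `1`, so only the intercity edges contribute.
  have h1 : matchingWeight (dualWeight J) (T.matchingOf X).1 =
      ∏ e ∈ satIntercity G X, dualWeight J e := by
    refine (Finset.prod_subset ?_ ?_).symm
    · exact fun e he => (T.mem_matchingOf_iff X e (hmem he)).2 he
    · intro e he hne
      rw [dualWeight, dif_neg]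
      exact fun hI => hne ((T.mem_matchingOf_iff X e hI).1 he)
  have h2 : ∏ e ∈ satIntercity G X, dualWeight J e =
      ∏ e ∈ Finset.univ.filter (fun e : G.edgeSet => edgeSpin X e = 1), Real.exp (2 * J e) := by
    refine Finset.prod_bij (fun e he => crossed ⟨e, hmem he⟩) ?_ ?_ ?_ ?_
    · intro e he
      obtain ⟨d, rfl, hd⟩ := mem_satIntercity.1 he
      rw [Finset.mem_filter, crossed_mk, edgeSpin_edge, key]
      exact ⟨Finset.mem_univ _, hd⟩
    · intro e he e' he' h
      obtain ⟨d, rfl, -⟩ := mem_satIntercity.1 he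
      obtain ⟨d', rfl, -⟩ := mem_satIntercity.1 he'
      rw [Subtype.ext_iff, crossed_mk, crossed_mk, SimpleGraph.dart_edge_eq_iff] at h
      rcases h with rfl | rfl
      · rfl
      · rw [SimpleGraph.Dart.symm_symm, Sym2.eq_swap]
    · rintro ⟨e, he⟩ hs
      induction e with
      | h a b =>
        let d : G.Dart := ⟨(a, b), he⟩
        have hd : s(d, d.symm) ∈ satIntercity G X :=
          mem_satIntercity.2 ⟨d, rfl, (key _ _).1 (Finset.mem_filter.1 hs).2⟩
        exact ⟨_, hd, Subtype.ext (crossed_mk d (hmem hd))⟩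
    · intro e he
      rw [dualWeight, dif_pos (hmem he)]
  rw [h1, h2, isingWeight, ← Real.exp_add, ← Real.exp_sum, Finset.sum_filter]
  congr 1
  simp only [Pi.zero_apply, zero_mul, Finset.sum_const_zero, zero_add]
  rw [← Finset.sum_add_distrib]
  refine Finset.sum_congr rfl fun e _ => ?_
  rcases Int.units_eq_one_or (edgeSpin X e) with h | h
  · rw [if_pos h, h]; push_cast; ring
  · rw [if_neg (by rw [h]; decide), h]; push_cast; ring

/-- The sum of the weights of `M(X)` over all `X` is computed twice: by fibres of size two, and by
the weight identity. -/
theorem matchingZ_expandedDual (J : G.edgeSet → ℝ) :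
    matchingZ T.expandedDual (dualWeight J) =
      (1 / 2) * isingZ G 0 J * Real.exp (∑ e : G.edgeSet, J e) := by
  classical
  have h1 : ∑ X : SpinConfig V, matchingWeight (dualWeight J) (T.matchingOf X).1 =
      2 * matchingZ T.expandedDual (dualWeight J) := by
    rw [← Finset.sum_fiberwise Finset.univ T.matchingOf, matchingZ,
      ← Finset.sum_coe_sort (perfectMatchings T.expandedDual), Finset.mul_sum]
    refine Finset.sum_congr rfl fun E _ => ?_
    rw [Finset.sum_congr rfl (g := fun _ => matchingWeight (dualWeight J) E.1),
      Finset.sum_const, card_fiber_matchingOf, nsmul_eq_mul, Nat.cast_ofNat]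
    intro X hX
    rw [(Finset.mem_filter.1 hX).2]
  simp only [matchingWeight_matchingOf, ← Finset.sum_mul] at h1
  rw [isingZ]
  linarith

theorem map_isingLaw_toReal (J : G.edgeSet → ℝ) (E : perfectMatchings T.expandedDual) :
    (((isingLaw G 0 J).map T.matchingOf) E).toReal =
      (1 / matchingZ T.expandedDual (dualWeight J)) * matchingWeight (dualWeight J) E.1 := by
  classical
  have hpos : ∀ X : SpinConfig V, 0 ≤ isingWeight G 0 J X / isingZ G 0 J :=
    fun X => div_nonneg (Real.exp_pos _).le (isingZ_pos G 0 J).le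
  have h1 : (((isingLaw G 0 J).map T.matchingOf) E).toReal =
      ∑ X ∈ Finset.univ.filter (fun X => T.matchingOf X = E),
        isingWeight G 0 J X / isingZ G 0 J := by
    rw [PMF.map_apply, tsum_fintype, Finset.sum_filter, ENNReal.toReal_sum]
    · refine Finset.sum_congr rfl fun X _ => ?_
      by_cases h : T.matchingOf X = E
      · rw [if_pos h.symm, if_pos h, isingLaw, PMF.ofFintype_apply, ENNReal.toReal_ofReal (hpos X)]
      · rw [if_neg (Ne.symm h), if_neg h, ENNReal.toReal_zero]
    · intro X _
      split_ifs
      · exact PMF.apply_ne_top _ _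
      · exact ENNReal.zero_ne_top
  have hexp := Real.exp_pos (∑ e : G.edgeSet, J e)
  have hZ := isingZ_pos G 0 J
  -- Both configurations in the fibre have the same probability; their number `2` cancels the `1 /
  -- 2` in the formula for `Z*`.
  rw [h1, Finset.sum_congr rfl (g := fun _ => matchingWeight (dualWeight J) E.1 /
    Real.exp (∑ e : G.edgeSet, J e) / isingZ G 0 J), Finset.sum_const, card_fiber_matchingOf,
    matchingZ_expandedDual]
  · rw [nsmul_eq_mul]
    field_simp
    push_cast
    ring
  · intro X hX
    rw [← (Finset.mem_filter.1 hX).2, matchingWeight_matchingOf, mul_div_cancel_right₀ _ hexp.ne']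

end PlaneTriangulation

end PlanarIsing

theorem mainTheorem10 {V : Type*} [Fintype V] [DecidableEq V] (G : SimpleGraph V)
    [DecidableRel G.Adj] (T : PlanarIsing.PlaneTriangulation G) (J : G.edgeSet → ℝ) :
    (∀ E : PlanarIsing.perfectMatchings T.expandedDual,
      (((PlanarIsing.isingLaw G 0 J).map T.matchingOf) E).toReal =
        (1 / PlanarIsing.matchingZ T.expandedDual (PlanarIsing.PlaneTriangulation.dualWeight J)) *
          PlanarIsing.matchingWeight (PlanarIsing.PlaneTriangulation.dualWeight J) E.1) ∧
    PlanarIsing.matchingZ T.expandedDual (PlanarIsing.PlaneTriangulation.dualWeight J) =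
      (1 / 2) * PlanarIsing.isingZ G 0 J * Real.exp (∑ e : G.edgeSet, J e) :=
  ⟨T.map_isingLaw_toReal J, T.matchingZ_expandedDual J⟩
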